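/- Let $\varepsilon\in(0,1)$. For a finite set $S\subset\mathbb{R}$, a $(1+\varepsilon)$-spanner for $S$ is a graph on the vertex set $S$, with edge lengths $|p-q|$, in which any two points $p,q\in S$ are joined by a path of length at most $(1+\varepsilon)|p-q|$; its weight is the sum of the lengths of its edges. An online $(1+\varepsilon)$-spanner algorithm receives distinct points $s_1,s_2,\dots$ of the real line one by one. After the arrival of $s_i$ it has a $(1+\varepsilon)$-spanner $G_i$ for $\{s_1,\dots,s_i\}$, which depends only on $(s_1,\dots,s_i)$ and contains all edges of $G_{i-1}$. (Edges may be added, but never removed.) Its competitive ratio on $n$ points is the supremum, over all sequences $\sigma=(s_1,\dots,s_n)$ of $n$ distinct points, of $\mathrm{ALG}(\sigma)/\mathrm{OPT}(\sigma)$, where $\mathrm{ALG}(\sigma)$ is the weight of $G_n$ and $\mathrm{OPT}(\sigma)$ is the minimum weight of a $(1+\varepsilon)$-spanner for $\{s_1,\dots,s_n\}$. **Theorem.** (Lower bound) For every $\varepsilon_0\in(0,1)$ there is a constant $c>0$, depending only on $\varepsilon_0$, such that for all $0<\varepsilon\le\varepsilon_0$ and all integers $n\ge\varepsilon^{-1}$,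 every online $(1+\varepsilon)$-spanner algorithm for points on a line has competitive ratio at least $$c\,\varepsilon^{-1}\,\frac{\log n}{\log\varepsilon^{-1}}$$ on $n$ points. (Upper bound) There is an absolute constant $C>0$ such that for every $\varepsilon\in(0,1)$ there is an online $(1+\varepsilon)$-spanner algorithm for points on a line whose competitive ratio on $n$ points is at most $$C\,\varepsilon^{-1}\,\frac{\log n}{\log\varepsilon^{-1}}$$ for every $n\ge 2$. -/

import Mathlib

namespace OnlineSpanner

/-- The length of an edge: the distance between the positions `s i` and `s j` of its ends. -/
noncomputable def edgeLength {X : Type*} [PseudoMetricSpace X] {ι : Type*} (s : ι → X) :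
    Sym2 ι → ℝ :=
  Sym2.lift ⟨fun i j => dist (s i) (s j), fun i j => dist_comm (s i) (s j)⟩

/-- The length of a walk: the sum of the lengths of its edges. -/
noncomputable def walkLength {X : Type*} [PseudoMetricSpace X] {ι : Type*} (s : ι → X)
    {G : SimpleGraph ι} {i j : ι} (p : G.Walk i j) : ℝ :=
  (p.edges.map (edgeLength s)).sum

open Classical in
/-- The weight of a graph on the points `s i`: the sum of the lengths of its edges. -/
noncomputable def weight {X : Type*} [PseudoMetricSpace X] {ι : Type*} [Fintype ι] (s : ι → X)
    (G : SimpleGraph ι) : ℝ :=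
  ∑ e : Sym2 ι with e ∈ G.edgeSet, edgeLength s e

/-- `G` is a `t`-spanner for the points `s i`: any two of them are joined in `G` by a path of
length at most `t` times their distance. -/
def IsSpanner {X : Type*} [PseudoMetricSpace X] {ι : Type*} (t : ℝ) (s : ι → X)
    (G : SimpleGraph ι) : Prop :=
  ∀ i j : ι, ∃ p : G.Walk i j, p.IsPath ∧ walkLength s p ≤ t * dist (s i) (s j)

/-- `OPT`: the minimum weight of a `t`-spanner for the points `s i`. -/
noncomputable def optWeight {X : Type*} [PseudoMetricSpace X] {ι : Type*} [Fintype ι] (t : ℝ)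
    (s : ι → X) : ℝ :=
  sInf {w : ℝ | ∃ G : SimpleGraph ι, IsSpanner t s G ∧ weight s G = w}

/-- A (deterministic) online `t`-spanner algorithm for sequences of distinct points of `X`.
After the points `s 0, …, s (n - 1)` have arrived, its graph `graph n s` on them is a function of
these points alone; it is a `t`-spanner, and it contains all edges of the graph that the algorithm
had before the last point arrived (edges may be added, between any points present, but
never removed). -/
structure OnlineAlgorithm (X : Type*) [PseudoMetricSpace X] (t : ℝ) where
  graph : (n : ℕ) → (Fin n → X) → SimpleGraph (Fin n)
  isSpanner : ∀ (n : ℕ) (s : Fin n → X), Function.Injective s → IsSpanner t s (graph n s)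
  mono : ∀ (n : ℕ) (s : Fin (n + 1) → X), Function.Injective s →
    (graph n (Fin.init s)).map Fin.castSuccEmb ≤ graph (n + 1) s

/-- The competitive ratio on sequences of `n` distinct points:
the supremum of `ALG / OPT` over all such sequences. -/
noncomputable def competitiveRatio {X : Type*} [PseudoMetricSpace X] {t : ℝ}
    (A : OnlineAlgorithm X t) (n : ℕ) : ENNReal :=
  ⨆ (s : Fin n → X) (_ : Function.Injective s),
    ENNReal.ofReal (weight s (A.graph n s) / optWeight t s)

end OnlineSpanner

/-! Lower bound. Let a new point have its right neighbour at distance `r` and all earlier points on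
its left at distance at least `l`, with `ε r < 2 l`. A short path to the right neighbour cannot
start leftwards, since the detour costs `2 l`; so a new edge of length at least `r` is forced
(`weight_add_le_of_isSpanner`). For `m` of order `1/ε`, fill `[0, 1]` in levels: level `k` cuts each
interval of length `m^-k` into `m` parts, inserting its division points from left to right. Left
gaps are then at least `m^-(k+1)`, while the right gaps of one level add up to order `m`. There are
about `log n / log m` levels, and the sorted path shows that OPT is at most 1.

Upper bound. The greedy algorithm joins a new point to its neighbours unless the gap lies below an
edge longer by a factor of at most `1 + η`, where `η = ε/3`. Each gap holds a credit `k`, at most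
its length, and lies below an edge exceeding it by at most `η k`. When a gap splits into parts `p ≤
q`, reusing the old edge for `q` adds `p` to the excess, so weight plus credit grows by at most `p +
min(q, p/η)` (`exists_credit`). The potential is the diameter `D` times the Shannon entropy of the
gap lengths divided by `D`. It grows by at least `p log((p+q)/p)`, which pays for the split up to a
factor `4/(η log η⁻¹)` (`add_min_le_entropy`). The entropy is at most `log n`, and `D` is at most
OPT. -/

namespace OnlineSpanner

/-! ### Walk lengths, graph weights and the optimum -/

section Basic

variable {X : Type*} [PseudoMetricSpace X] {ι κ : Type*} (s : ι → X)

@[simp] lemma edgeLength_mk (i j : ι) : edgeLength s s(i, j) = dist (s i) (s j) := rfl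

lemma edgeLength_nonneg (e : Sym2 ι) : 0 ≤ edgeLength s e := by
  induction e with | _ i j => exact dist_nonneg

@[simp] lemma walkLength_nil {G : SimpleGraph ι} (i : ι) :
    walkLength s (SimpleGraph.Walk.nil : G.Walk i i) = 0 := by
  simp [walkLength]

@[simp] lemma walkLength_cons {G : SimpleGraph ι} {i j k : ι} (h : G.Adj i j) (p : G.Walk j k) :
    walkLength s (SimpleGraph.Walk.cons h p) = dist (s i) (s j) + walkLength s p := by
  simp [walkLength]

@[simp] lemma walkLength_append {G : SimpleGraph ι} {i j k : ι} (p : G.Walk i j) (q : G.Walk j k) :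
    walkLength s (p.append q) = walkLength s p + walkLength s q := by
  simp [walkLength]

@[simp] lemma walkLength_reverse {G : SimpleGraph ι} {i j : ι} (p : G.Walk i j) :
    walkLength s p.reverse = walkLength s p := by
  simp [walkLength]

lemma dist_le_walkLength {G : SimpleGraph ι} {i j : ι} (p : G.Walk i j) :
    dist (s i) (s j) ≤ walkLength s p := by
  induction p with
  | nil => simp
  | cons h p ih =>
    rw [walkLength_cons]
    exact (dist_triangle _ _ _).trans (by gcongr)

lemma exists_isPath_walkLength_le {G : SimpleGraph ι} {i j : ι} (p : G.Walk i j) :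
    ∃ q : G.Walk i j, q.IsPath ∧ walkLength s q ≤ walkLength s p := by
  classical
  refine ⟨p.bypass, p.bypass_isPath, ?_⟩
  unfold walkLength
  refine (p.edges_bypass_sublist_edges.map (edgeLength s)).sum_le_sum ?_
  simp only [List.mem_map]
  rintro _ ⟨e, -, rfl⟩
  exact edgeLength_nonneg s e

lemma isSpanner_of_walk {t : ℝ} {G : SimpleGraph ι}
    (h : ∀ i j, ∃ p : G.Walk i j, walkLength s p ≤ t * dist (s i) (s j)) : IsSpanner t s G := by
  intro i j
  obtain ⟨p, hp⟩ := h i j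
  obtain ⟨q, hq, hqp⟩ := exists_isPath_walkLength_le s p
  exact ⟨q, hq, hqp.trans hp⟩

variable [Fintype ι] [Fintype κ]

lemma sum_le_weight {G : SimpleGraph ι} (S : Finset (Sym2 ι)) (hS : ∀ e ∈ S, e ∈ G.edgeSet) :
    ∑ e ∈ S, edgeLength s e ≤ weight s G := by
  classical
  unfold weight
  refine Finset.sum_le_sum_of_subset_of_nonneg (fun e he => ?_)
    (fun e _ _ => edgeLength_nonneg s e)
  simpa using hS e he

lemma weight_le_sum {G : SimpleGraph ι} (S : Finset (Sym2 ι)) (hS : ∀ e ∈ G.edgeSet, e ∈ S) :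
    weight s G ≤ ∑ e ∈ S, edgeLength s e := by
  classical
  unfold weight
  refine Finset.sum_le_sum_of_subset_of_nonneg (fun e he => ?_)
    (fun e _ _ => edgeLength_nonneg s e)
  exact hS e (by simpa using he)

lemma weight_eq_sum {G : SimpleGraph ι} (S : Finset (Sym2 ι)) (hS : ∀ e, e ∈ S ↔ e ∈ G.edgeSet) :
    weight s G = ∑ e ∈ S, edgeLength s e :=
  le_antisymm (weight_le_sum s S fun e => (hS e).2) (sum_le_weight s S fun e => (hS e).1)

lemma exists_edgeFinset (G : SimpleGraph ι) :
    ∃ S : Finset (Sym2 ι), ∀ e, e ∈ S ↔ e ∈ G.edgeSet := by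
  classical
  exact ⟨Finset.univ.filter (· ∈ G.edgeSet), fun e => by simp⟩

lemma weight_nonneg (G : SimpleGraph ι) : 0 ≤ weight s G := by
  simpa using sum_le_weight s (G := G) ∅ (by simp)

lemma weight_map (s : κ → X) (f : ι ↪ κ) (G : SimpleGraph ι) :
    weight s (G.map f) = weight (s ∘ f) G := by
  obtain ⟨S, hS⟩ := exists_edgeFinset G
  rw [weight_eq_sum _ S hS, weight_eq_sum s (S.map f.sym2Map), Finset.sum_map]
  · refine Finset.sum_congr rfl fun e _ => ?_
    induction e with | _ i j => rfl
  · intro e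
    simp [SimpleGraph.edgeSet_map, hS]

lemma weight_sup_le (G H : SimpleGraph ι) : weight s (G ⊔ H) ≤ weight s G + weight s H := by
  classical
  obtain ⟨S, hS⟩ := exists_edgeFinset G
  obtain ⟨T, hT⟩ := exists_edgeFinset H
  rw [weight_eq_sum _ S hS, weight_eq_sum _ T hT, ← Finset.sum_union_inter]
  refine (weight_le_sum s (S ∪ T) fun e he => ?_).trans
    (le_add_of_nonneg_right (Finset.sum_nonneg fun e _ => edgeLength_nonneg s e))
  simpa [hS, hT] using he

lemma weight_add_edgeLength_le {G H : SimpleGraph ι} (hGH : G ≤ H) {i j : ι} (hij : H.Adj i j)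
    (hG : ¬ G.Adj i j) : weight s G + dist (s i) (s j) ≤ weight s H := by
  classical
  obtain ⟨S, hS⟩ := exists_edgeFinset G
  have hnot : s(i, j) ∉ S := by simpa [hS] using hG
  rw [weight_eq_sum _ S hS, add_comm, ← edgeLength_mk, ← Finset.sum_insert hnot]
  refine sum_le_weight s _ fun e he => ?_
  rcases Finset.mem_insert.1 he with rfl | he
  · exact hij
  · exact SimpleGraph.edgeSet_mono hGH ((hS e).1 he)

-- A path repeats no edge, so its length is a partial sum of the weight.
variable {s} in
lemma IsSpanner.dist_le_weight {t : ℝ} {G : SimpleGraph ι} (h : IsSpanner t s G) (i j : ι) :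
    dist (s i) (s j) ≤ weight s G := by
  classical
  obtain ⟨p, hp, -⟩ := h i j
  refine (dist_le_walkLength s p).trans ?_
  have := sum_le_weight s (G := G) p.edges.toFinset
    fun e he => p.edges_subset_edgeSet (List.mem_toFinset.1 he)
  rwa [List.sum_toFinset _ hp.isTrail.edges_nodup] at this

variable {s} in
lemma optWeight_le {t : ℝ} {G : SimpleGraph ι} (h : IsSpanner t s G) :
    optWeight t s ≤ weight s G :=
  csInf_le ⟨0, by rintro _ ⟨H, -, rfl⟩; exact weight_nonneg s H⟩ ⟨G, h, rfl⟩

variable {s} in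
lemma dist_le_optWeight {t : ℝ} {G : SimpleGraph ι} (h : IsSpanner t s G) (i j : ι) :
    dist (s i) (s j) ≤ optWeight t s :=
  le_csInf ⟨_, G, h, rfl⟩ (by rintro _ ⟨H, hH, rfl⟩; exact hH.dist_le_weight i j)

end Basic

/-! ### Gaps on the line and a local criterion for spanners -/

/-- `g i` is the distance from `s i` to the next of the points to its right,
and `0` for the rightmost point. -/
structure IsGap {ι : Type*} (s g : ι → ℝ) : Prop where
  sep : ∀ i k, s k ≤ s i ∨ s i + g i ≤ s k
  next : ∀ i, (g i = 0 ∧ ∀ k, s k ≤ s i) ∨ (0 < g i ∧ ∃ j, s j = s i + g i)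

section Gap

variable {ι : Type*} {s g : ι → ℝ}

lemma IsGap.nonneg (h : IsGap s g) (i : ι) : 0 ≤ g i := by
  rcases h.next i with h | h
  · exact h.1.ge
  · exact h.1.le

/-- Induction on the distance of the pair. A longer pair splits at the next point. A consecutive
pair uses its covering edge, whose two overhangs are shorter than the gap and are walked back by
induction. As the overhangs total at most `ε/3` of the gap, the walk costs at most `1 + ε/3 + (1 +
ε) ε/3 ≤ 1 + ε` times the gap. -/
lemma IsGap.exists_walk [Finite ι] (hs : Function.Injective s) (h : IsGap s g) {ε : ℝ} (hε : 0 < ε)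
    (hε1 : ε < 1) {G : SimpleGraph ι}
    (hG : ∀ i, 0 < g i → ∃ a b, G.Adj a b ∧ s a ≤ s i ∧ s i + g i ≤ s b ∧
      s b - s a ≤ (1 + ε / 3) * g i) :
    ∀ x : ι × ι, s x.1 ≤ s x.2 →
      ∃ p : G.Walk x.1 x.2, walkLength s p ≤ (1 + ε) * (s x.2 - s x.1) := by
  let R : ι × ι → ι × ι → Prop := fun x y => s x.2 - s x.1 < s y.2 - s y.1
  have : IsTrans (ι × ι) R := ⟨fun a b c => lt_trans⟩
  have : Std.Irrefl R := ⟨fun a => lt_irrefl _⟩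
  have wf : WellFounded R := Finite.wellFounded_of_trans_of_irrefl R
  intro x
  induction x using wf.induction with
  | _ x ih =>
  obtain ⟨i, j⟩ := x
  intro hij
  change s i ≤ s j at hij
  change ∃ p : G.Walk i j, walkLength s p ≤ (1 + ε) * (s j - s i)
  rcases hij.eq_or_lt with hij | hij
  · obtain rfl := hs hij
    exact ⟨.nil, by simp⟩
  rcases h.next i with ⟨-, h0⟩ | ⟨hpos, k, hk⟩
  · exact absurd (h0 j) (not_le.2 hij)
  have hkj : s k ≤ s j := by
    rcases h.sep i j with h' | h' <;> linarith
  rcases hkj.eq_or_lt with hkj | hkj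
  · obtain rfl := hs hkj
    obtain ⟨a, b, hab, hai, hib, hlen⟩ := hG i hpos
    have h3 : ε / 3 * g i < g i := by nlinarith
    obtain ⟨p, hp⟩ := ih (a, i) (by change s i - s a < s k - s i; nlinarith) hai
    obtain ⟨q, hq⟩ := ih (k, b) (by change s b - s k < s k - s i; nlinarith)
      (by change s k ≤ s b; linarith)
    refine ⟨p.reverse.append (.cons hab q.reverse), ?_⟩
    have hd : dist (s a) (s b) = s b - s a := by
      rw [dist_comm, Real.dist_eq, abs_of_nonneg]; linarith
    simp only [walkLength_append, walkLength_reverse, walkLength_cons, hd]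
    change walkLength s p ≤ (1 + ε) * (s i - s a) at hp
    change walkLength s q ≤ (1 + ε) * (s b - s k) at hq
    have hgi : g i = s k - s i := by linarith
    rw [hgi] at hlen
    nlinarith [mul_pos hε hpos, mul_pos (mul_pos hε hε) hpos,
      mul_nonneg (mul_pos hε hpos).le (sub_nonneg.2 hε1.le)]
  · obtain ⟨p, hp⟩ := ih (i, k) (by change s k - s i < s j - s i; linarith)
      (by change s i ≤ s k; linarith)
    obtain ⟨q, hq⟩ := ih (k, j) (by change s j - s k < s j - s i; linarith) hkj.le
    refine ⟨p.append q, ?_⟩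
    rw [walkLength_append]
    change walkLength s p ≤ (1 + ε) * (s k - s i) at hp
    change walkLength s q ≤ (1 + ε) * (s j - s k) at hq
    linarith

/-- A graph in which every gap between consecutive points lies below an edge that is not much
longer is a spanner. -/
lemma IsGap.isSpanner [Fintype ι] (hs : Function.Injective s) (h : IsGap s g) {ε : ℝ} (hε : 0 < ε)
    (hε1 : ε < 1) {G : SimpleGraph ι}
    (hG : ∀ i, 0 < g i → ∃ a b, G.Adj a b ∧ s a ≤ s i ∧ s i + g i ≤ s b ∧
      s b - s a ≤ (1 + ε / 3) * g i) : IsSpanner (1 + ε) s G := by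
  refine isSpanner_of_walk s fun i j => ?_
  rcases le_total (s i) (s j) with hij | hij
  · obtain ⟨p, hp⟩ := h.exists_walk hs hε hε1 hG (i, j) hij
    refine ⟨p, ?_⟩
    rwa [dist_comm, Real.dist_eq, abs_of_nonneg (sub_nonneg.2 hij)]
  · obtain ⟨p, hp⟩ := h.exists_walk hs hε hε1 hG (j, i) hij
    refine ⟨p.reverse, ?_⟩
    rwa [Real.dist_eq, abs_of_nonneg (sub_nonneg.2 hij), walkLength_reverse]

/-- The path through the points in sorted order is a spanner. -/
lemma IsGap.optWeight_le_sum [Fintype ι] (hs : Function.Injective s) (h : IsGap s g) {ε : ℝ}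
    (hε : 0 < ε) (hε1 : ε < 1) : optWeight (1 + ε) s ≤ ∑ i, g i := by
  classical
  have hn : ∀ i, ∃ j, 0 < g i → s j = s i + g i := by
    intro i
    rcases h.next i with h | ⟨-, j, hj⟩
    · exact ⟨i, fun h' => absurd h' (by rw [h.1]; exact lt_irrefl 0)⟩
    · exact ⟨j, fun _ => hj⟩
  choose nxt hnxt using hn
  let T : Finset ι := Finset.univ.filter (0 < g ·)
  have hT : ∀ i ∈ T, dist (s i) (s (nxt i)) = g i := by
    intro i hi
    have hi : 0 < g i := by simpa [T] using hi
    rw [hnxt i hi, dist_comm, Real.dist_eq, add_sub_cancel_left, abs_of_pos hi]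
  let G : SimpleGraph ι := SimpleGraph.fromEdgeSet (T.image fun i => s(i, nxt i) : Finset (Sym2 ι))
  have hG : IsSpanner (1 + ε) s G := by
    refine h.isSpanner hs hε hε1 fun i hi => ⟨i, nxt i, ?_, le_rfl, (hnxt i hi).ge, ?_⟩
    · refine (SimpleGraph.fromEdgeSet_adj _).2 ⟨Finset.mem_image_of_mem _ (by simpa [T] using hi), ?_⟩
      intro he
      have := hnxt i hi
      rw [← he] at this
      linarith
    · rw [hnxt i hi]
      nlinarith
  refine (optWeight_le hG).trans ?_
  calc weight s G ≤ ∑ e ∈ T.image fun i => s(i, nxt i), edgeLength s e :=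
        weight_le_sum s _ fun e he => by
          rw [SimpleGraph.edgeSet_fromEdgeSet] at he
          exact he.1
    _ ≤ ∑ i ∈ T, edgeLength s s(i, nxt i) :=
        Finset.sum_image_le_of_nonneg fun i _ => edgeLength_nonneg s _
    _ = ∑ i ∈ T, g i := Finset.sum_congr rfl hT
    _ ≤ ∑ i, g i :=
        Finset.sum_le_sum_of_subset_of_nonneg (Finset.subset_univ T) fun i _ _ => h.nonneg i

end Gap

/-! ### The greedy algorithm and the credit of a new gap -/

/-- The pair `i, j` lies below an edge of `H` that is longer by a factor of at most `1 + η`. -/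
def Covered {ι : Type*} (η : ℝ) (s : ι → ℝ) (H : SimpleGraph ι) (i j : ι) : Prop :=
  ∃ a b, H.Adj a b ∧ s a ≤ s i ∧ s j ≤ s b ∧ s b - s a ≤ (1 + η) * (s j - s i)

/-- Joins `c` to its left and right neighbour, unless the gap between them is covered. -/
def extend {ι : Type*} (η : ℝ) (s : ι → ℝ) (c : ι) (H : SimpleGraph ι) : SimpleGraph ι :=
  H ⊔ SimpleGraph.fromEdgeSet {e | ∃ i j, e = s(i, j) ∧ (i = c ∨ j = c) ∧ s i < s j ∧
    (∀ k, s k ≤ s i ∨ s j ≤ s k) ∧ ¬ Covered η s H i j}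

/-- The graph of the lazy greedy online algorithm. -/
def greedy (η : ℝ) : (n : ℕ) → (Fin n → ℝ) → SimpleGraph (Fin n)
  | 0, _ => ⊥
  | n + 1, s => extend η s (Fin.last n) ((greedy η n (Fin.init s)).map Fin.castSuccEmb)

section Extend

variable {ι : Type*} {η : ℝ} {s : ι → ℝ} {c : ι} {H : SimpleGraph ι}

lemma le_extend : H ≤ extend η s c H := le_sup_left

lemma extend_adj {i j : ι} (hc : i = c ∨ j = c) (hij : s i < s j)
    (h : ∀ k, s k ≤ s i ∨ s j ≤ s k) (hC : ¬ Covered η s H i j) : (extend η s c H).Adj i j :=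
  Or.inr ((SimpleGraph.fromEdgeSet_adj _).2
    ⟨⟨i, j, rfl, hc, hij, h, hC⟩, fun he => hij.ne (congrArg s he)⟩)

open Classical in
lemma weight_extend_le [Fintype ι] (T : Finset (ι × ι)) (hTs : ∀ x ∈ T, s x.1 ≤ s x.2)
    (hT : ∀ i j, i = c ∨ j = c → s i < s j → (∀ k, s k ≤ s i ∨ s j ≤ s k) → (i, j) ∈ T) :
    weight s (extend η s c H) ≤
      weight s H + ∑ x ∈ T, if Covered η s H x.1 x.2 then 0 else s x.2 - s x.1 := by
  refine (weight_sup_le s _ _).trans ?_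
  gcongr
  calc _ ≤ ∑ e ∈ (T.filter fun x => ¬ Covered η s H x.1 x.2).image fun x => s(x.1, x.2),
        edgeLength s e := by
        refine weight_le_sum s _ fun e he => ?_
        rw [SimpleGraph.edgeSet_fromEdgeSet] at he
        obtain ⟨⟨i, j, rfl, hc, hij, hk, hC⟩, -⟩ := he
        exact Finset.mem_image.2 ⟨(i, j), Finset.mem_filter.2 ⟨hT i j hc hij hk, hC⟩, rfl⟩
    _ ≤ ∑ x ∈ T.filter fun x => ¬ Covered η s H x.1 x.2, edgeLength s s(x.1, x.2) :=
        Finset.sum_image_le_of_nonneg fun i _ => edgeLength_nonneg s _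
    _ = ∑ x ∈ T.filter fun x => ¬ Covered η s H x.1 x.2, (s x.2 - s x.1) := by
        refine Finset.sum_congr rfl fun x hx => ?_
        rw [edgeLength_mk, dist_comm, Real.dist_eq, abs_of_nonneg]
        exact sub_nonneg.2 (hTs x (Finset.mem_filter.1 hx).1)
    _ = _ := by
        rw [Finset.sum_filter]
        simp only [ite_not]

open Classical in
/-- The cost of covering a new gap, plus the credit that it holds then, is at most its length and
at most the credit with which an old edge would cover it. -/
lemma exists_credit {G : SimpleGraph ι} (hη : 0 ≤ η) (hHG : H ≤ G) {i j : ι} (hij : s i < s j)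
    (hadd : ¬ Covered η s H i j → G.Adj i j) {E : ℝ} (hE : 0 ≤ E)
    (he : E < s j - s i →
      ∃ a b, H.Adj a b ∧ s a ≤ s i ∧ s j ≤ s b ∧ s b - s a ≤ s j - s i + η * E) :
    ∃ k, 0 ≤ k ∧ k ≤ s j - s i ∧
      (∃ a b, G.Adj a b ∧ s a ≤ s i ∧ s j ≤ s b ∧ s b - s a ≤ s j - s i + η * k) ∧
      (if Covered η s H i j then 0 else s j - s i) + k ≤ s j - s i ∧
      (if Covered η s H i j then 0 else s j - s i) + k ≤ E := by
  -- If `E` is below the length, the old edge covers the gap for free and the credit is `E`.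
  -- Otherwise either a covering edge leaves full credit, or the gap's own edge is bought and needs
  -- no credit.
  rcases lt_or_ge E (s j - s i) with hlt | hge
  · obtain ⟨a, b, hab, ha, hb, hlen⟩ := he hlt
    have hC : Covered η s H i j := ⟨a, b, hab, ha, hb, by nlinarith⟩
    exact ⟨E, hE, hlt.le, ⟨a, b, hHG hab, ha, hb, hlen⟩, by simp [hC, hlt.le], by simp [hC]⟩
  · by_cases hC : Covered η s H i j
    · obtain ⟨a, b, hab, ha, hb, hlen⟩ := id hC
      exact ⟨s j - s i, by linarith, le_rfl, ⟨a, b, hHG hab, ha, hb, by linarith⟩,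
        by simp [hC], by simpa [hC] using hge⟩
    · exact ⟨0, le_rfl, by linarith, ⟨i, j, hadd hC, le_rfl, le_rfl, by simp⟩,
        by simp [hC], by simpa [hC] using hge⟩

end Extend

/-! ### Entropy inequalities -/

section Entropy

open Real

/-- The right side is `p log((p+q)/p) + q log((p+q)/q)`, and the second term is nonnegative. -/
lemma mul_log_div_le_negMulLog {p q : ℝ} (hp : 0 < p) (hq : 0 < q) :
    p * log ((p + q) / p) ≤ negMulLog p + negMulLog q - negMulLog (p + q) := by
  have h : log q ≤ log (p + q) := log_le_log hq (by linarith)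
  rw [log_div (by positivity) (by positivity)]
  simp only [negMulLog]
  nlinarith

lemma negMulLog_add_le {p q : ℝ} (hp : 0 ≤ p) (hq : 0 ≤ q) :
    negMulLog (p + q) ≤ negMulLog p + negMulLog q := by
  rcases hp.eq_or_lt with rfl | hp
  · simp
  rcases hq.eq_or_lt with rfl | hq
  · simp
  have h := mul_log_div_le_negMulLog hp hq
  have : 0 ≤ p * log ((p + q) / p) :=
    mul_nonneg hp.le (log_nonneg (by rw [le_div_iff₀ hp]; linarith))
  linarith

/-- Splitting a gap raises the entropy enough to pay for covering the two parts. -/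
lemma add_min_le_entropy {η p q : ℝ} (hη : 0 < η) (hη1 : η < 1) (hp : 0 < p) (hpq : p ≤ q) :
    p + min q (p / η) ≤
      4 / (η * log η⁻¹) * (negMulLog p + negMulLog q - negMulLog (p + q)) := by
  have hq : 0 < q := hp.trans_le hpq
  have ha : 0 < log η⁻¹ := log_pos ((one_lt_inv₀ hη).2 hη1)
  set a := log η⁻¹ with ha_def
  set b := log ((p + q) / p) with hb_def
  have hb : 1 / 2 ≤ b := by
    have : log 2 ≤ b := log_le_log (by norm_num) (by rw [le_div_iff₀ hp]; linarith)
    linarith [log_two_gt_d9]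
  have hM : 0 ≤ 4 / (η * a) := by positivity
  refine le_trans ?_ (mul_le_mul_of_nonneg_left (mul_log_div_le_negMulLog hp hq) hM)
  rw [← hb_def, div_mul_eq_mul_div, le_div_iff₀ (by positivity)]
  -- For `(p+q)/p ≥ 1/η` the minimum is bounded by `p/η`, otherwise by `q`.
  rcases le_total a b with hab | hab
  · have h1 : p + min q (p / η) ≤ p + p / η := by gcongr; exact min_le_right _ _
    have h2 : (p + p / η) * (η * a) = p * (1 + η) * a := by field_simp; ring
    have h3 : (p + min q (p / η)) * (η * a) ≤ (p + p / η) * (η * a) := by gcongr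
    rw [h2] at h3
    have h4 : p * (1 + η) * a ≤ p * 2 * b := by gcongr; linarith
    nlinarith [mul_pos hp (by linarith : 0 < b)]
  · have h1 : (p + min q (p / η)) * (η * a) ≤ (p + q) * (η * a) := by
      gcongr; exact min_le_left _ _
    refine h1.trans ?_
    have h2 : a - b + 1 ≤ η⁻¹ * (p / (p + q)) := by
      have h := add_one_le_exp (a - b)
      rwa [exp_sub, ha_def, hb_def, exp_log (by positivity), exp_log (by positivity),
        div_eq_mul_inv η⁻¹, inv_div] at h
    have h3 : (a - b + 1) * (η * (p + q)) ≤ p := by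
      calc (a - b + 1) * (η * (p + q)) ≤ η⁻¹ * (p / (p + q)) * (η * (p + q)) := by gcongr
        _ = p := by field_simp
    -- The right side is concave in `b`, and it is at least `a` at both ends of `1/2 ≤ b ≤ a`.
    have h4 : a ≤ 4 * b * (a - b + 1) := by nlinarith
    have h5 : 0 < η * (p + q) := by positivity
    calc (p + q) * (η * a) = a * (η * (p + q)) := by ring
      _ ≤ 4 * b * (a - b + 1) * (η * (p + q)) := by gcongr
      _ = 4 * b * ((a - b + 1) * (η * (p + q))) := by ring
      _ ≤ 4 * b * p := by gcongr
      _ = 4 * (p * b) := by ring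

/-- Entropy is at most `log n`, scaled by the total `D`: apply `log x ≤ x - 1` at `x = D/(n g i)`
and sum. -/
lemma sum_negMulLog_sub_le {n : ℕ} (hn : 0 < n) (g : Fin n → ℝ) (hg : ∀ i, 0 ≤ g i) :
    ∑ i, negMulLog (g i) - negMulLog (∑ i, g i) ≤ (∑ i, g i) * log n := by
  set D := ∑ i, g i with hD
  have hn' : (0 : ℝ) < n := by exact_mod_cast hn
  have key : ∀ i, negMulLog (g i) + g i * log D - g i * log n ≤ D / n - g i := by
    intro i
    have hgD : g i ≤ D := Finset.single_le_sum (fun j _ => hg j) (Finset.mem_univ i)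
    rcases (hg i).eq_or_lt with h0 | hpos
    · rw [← h0]
      simp only [negMulLog_zero, zero_mul, sub_zero, add_zero]
      have : 0 ≤ D := (hg i).trans hgD
      positivity
    · have hDpos := hpos.trans_le hgD
      have h := log_le_sub_one_of_pos (show 0 < D / (n * g i) by positivity)
      rw [log_div (by positivity) (by positivity), log_mul (by positivity) (by positivity)] at h
      have h2 := mul_le_mul_of_nonneg_left h hpos.le
      have h3 : g i * (D / (n * g i) - 1) = D / n - g i := by field_simp
      rw [h3] at h2
      simp only [negMulLog]
      linarith
  have hsum := Finset.sum_le_sum fun i (_ : i ∈ Finset.univ) => key i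
  simp only [Finset.sum_sub_distrib, Finset.sum_add_distrib, ← Finset.sum_mul, ← hD,
    Finset.sum_const, Finset.card_univ, Fintype.card_fin, nsmul_eq_mul] at hsum
  rw [mul_div_cancel₀ _ hn'.ne'] at hsum
  simp only [negMulLog] at hsum ⊢
  linarith

end Entropy

/-! ### Amortized analysis of an insertion -/

/-- Witnesses for the amortized analysis: the gaps `g`, and a credit `k i` for each gap that bounds
the excess of an edge above the gap. -/
structure Certificate {n : ℕ} (η M : ℝ) (s : Fin n → ℝ) (G : SimpleGraph (Fin n))
    (g k : Fin n → ℝ) : Prop where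
  gap : IsGap s g
  nonneg : ∀ i, 0 ≤ k i
  le_gap : ∀ i, k i ≤ g i
  cover : ∀ i, 0 < g i → ∃ a b, G.Adj a b ∧ s a ≤ s i ∧ s i + g i ≤ s b ∧
    s b - s a ≤ g i + η * k i
  weight_le : weight s G + ∑ i, k i ≤
    M * (∑ i, Real.negMulLog (g i) - Real.negMulLog (∑ i, g i)) + ∑ i, g i
  diam : 0 < n → ∃ i j, (∀ l, s i ≤ s l ∧ s l ≤ s j) ∧ ∑ i, g i = s j - s i

lemma sum_comp_snoc_update {n : ℕ} (φ : ℝ → ℝ) (g : Fin n → ℝ) (x : Fin n) (p q : ℝ) :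
    ∑ i, φ (Fin.snoc (α := fun _ => ℝ) (Function.update g x p) q i) =
      ∑ i, φ (g i) - φ (g x) + φ p + φ q := by
  rw [Fin.sum_univ_castSucc]
  simp only [Fin.snoc_castSucc, Fin.snoc_last]
  rw [← Finset.add_sum_erase _ _ (Finset.mem_univ x),
    ← Finset.add_sum_erase _ (fun i => φ (g i)) (Finset.mem_univ x), Function.update_self]
  have : ∑ i ∈ Finset.univ.erase x, φ (Function.update g x p i) =
      ∑ i ∈ Finset.univ.erase x, φ (g i) :=
    Finset.sum_congr rfl fun i hi => by rw [Function.update_of_ne (Finset.ne_of_mem_erase hi)]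
  rw [this]
  ring

section Insert

variable {n : ℕ} {η M : ℝ} {s : Fin (n + 1) → ℝ} {G : SimpleGraph (Fin n)} {g k : Fin n → ℝ}

/-- Only one old gap changes, so the global invariant reduces to the local balance `hw`: `x` gets
the gap `p` and the new point the gap `q`. -/
lemma Certificate.snoc (h : Certificate η M (Fin.init s) G g k) {H : SimpleGraph (Fin (n + 1))}
    (hH : G.map Fin.castSuccEmb ≤ H) (x : Fin n) {p q kp kq : ℝ}
    (gap : IsGap s (Fin.snoc (α := fun _ => ℝ) (Function.update g x p) q))
    (hkp : 0 ≤ kp) (hkp' : kp ≤ p) (hkq : 0 ≤ kq) (hkq' : kq ≤ q)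
    (hp : 0 < p → ∃ a b, H.Adj a b ∧ s a ≤ s x.castSucc ∧ s x.castSucc + p ≤ s b ∧
      s b - s a ≤ p + η * kp)
    (hq : 0 < q → ∃ a b, H.Adj a b ∧ s a ≤ s (Fin.last n) ∧ s (Fin.last n) + q ≤ s b ∧
      s b - s a ≤ q + η * kq)
    (hw : weight s H - weight (Fin.init s) G + kp + kq - k x ≤
      M * (Real.negMulLog p + Real.negMulLog q - Real.negMulLog (g x) + Real.negMulLog (∑ i, g i)
        - Real.negMulLog (∑ i, g i - g x + p + q)) + (p + q - g x))
    (diam : ∃ i j, (∀ l, s i ≤ s l ∧ s l ≤ s j) ∧ ∑ i, g i - g x + p + q = s j - s i) :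
    Certificate η M s H (Fin.snoc (α := fun _ => ℝ) (Function.update g x p) q)
      (Fin.snoc (α := fun _ => ℝ) (Function.update k x kp) kq) where
  gap := gap
  nonneg := by
    rw [Fin.forall_fin_succ']
    simp only [Fin.snoc_castSucc, Fin.snoc_last]
    refine ⟨fun i => ?_, hkq⟩
    rcases eq_or_ne i x with rfl | hi
    · simpa
    · simpa [hi] using h.nonneg i
  le_gap := by
    rw [Fin.forall_fin_succ']
    simp only [Fin.snoc_castSucc, Fin.snoc_last]
    refine ⟨fun i => ?_, hkq'⟩
    rcases eq_or_ne i x with rfl | hi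
    · simpa
    · simpa [hi] using h.le_gap i
  cover := by
    rw [Fin.forall_fin_succ']
    simp only [Fin.snoc_castSucc, Fin.snoc_last]
    refine ⟨fun i => ?_, hq⟩
    rcases eq_or_ne i x with rfl | hi
    · simpa using hp
    · simp only [Function.update_of_ne hi]
      intro hgi
      obtain ⟨a, b, hab, hh⟩ := h.cover i hgi
      exact ⟨a.castSucc, b.castSucc, hH (SimpleGraph.map_adj_apply.2 hab), hh⟩
  weight_le := by
    have hg := sum_comp_snoc_update (fun x => x) g x p q
    have hk := sum_comp_snoc_update (fun x => x) k x kp kq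
    beta_reduce at hg hk
    rw [sum_comp_snoc_update Real.negMulLog, hg, hk]
    linarith [h.weight_le]
  diam := by
    intro _
    have hg := sum_comp_snoc_update (fun x => x) g x p q
    beta_reduce at hg
    rwa [hg]

/-- A new point in a gap. -/
lemma Certificate.insert_between (hs : Function.Injective s) (hη : 0 < η) (hη1 : η < 1)
    (h : Certificate η (4 / (η * Real.log η⁻¹)) (Fin.init s) G g k)
    {x y : Fin n} (hxy : s y.castSucc = s x.castSucc + g x)
    (hx : s x.castSucc < s (Fin.last n)) (hy : s (Fin.last n) < s y.castSucc) :
    ∃ g' k', Certificate η (4 / (η * Real.log η⁻¹)) s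
      (extend η s (Fin.last n) (G.map Fin.castSuccEmb)) g' k' := by
  classical
  set c := Fin.last n with hc
  set H := G.map Fin.castSuccEmb with hH
  have hsep : ∀ i l : Fin n, s l.castSucc ≤ s i.castSucc ∨ s i.castSucc + g i ≤ s l.castSucc :=
    h.gap.sep
  have hgx : 0 < g x := by linarith
  have hcons₁ : ∀ l, s l ≤ s x.castSucc ∨ s c ≤ s l := by
    rw [Fin.forall_fin_succ']
    refine ⟨fun l => ?_, Or.inr le_rfl⟩
    rcases hsep x l with h' | h'
    · exact Or.inl h'
    · exact Or.inr (by linarith)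
  have hcons₂ : ∀ l, s l ≤ s c ∨ s y.castSucc ≤ s l := by
    rw [Fin.forall_fin_succ']
    refine ⟨fun l => ?_, Or.inl le_rfl⟩
    rcases hsep x l with h' | h'
    · exact Or.inl (by linarith)
    · exact Or.inr (by linarith)
  obtain ⟨a, b, hab, hax, hxb, hlen⟩ := h.cover x hgx
  replace hab : H.Adj a.castSucc b.castSucc := SimpleGraph.map_adj_apply.2 hab
  replace hax : s a.castSucc ≤ s x.castSucc := hax
  replace hxb : s x.castSucc + g x ≤ s b.castSucc := hxb
  replace hlen : s b.castSucc - s a.castSucc ≤ g x + η * k x := hlen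
  have hkx := h.nonneg x
  -- An old edge reused for one part has the other part as additional excess. Dividing that by `η`
  -- converts it to credit, hence `E` here and below.
  obtain ⟨kp, hkp, hkp', hcp, hp₁, hp₂⟩ := exists_credit (G := extend η s c H) hη.le le_extend hx
    (extend_adj (Or.inr rfl) hx hcons₁) (E := k x + (s y.castSucc - s c) / η)
    (by have := div_pos (sub_pos.2 hy) hη; linarith)
    (fun _ => ⟨_, _, hab, hax, by linarith, by rw [mul_add, mul_div_cancel₀ _ hη.ne']; linarith⟩)
  obtain ⟨kq, hkq, hkq', hcq, hq₁, hq₂⟩ := exists_credit (G := extend η s c H) hη.le le_extend hy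
    (extend_adj (Or.inl rfl) hy hcons₂) (E := k x + (s c - s x.castSucc) / η)
    (by have := div_pos (sub_pos.2 hx) hη; linarith)
    (fun _ => ⟨_, _, hab, by linarith, by linarith,
      by rw [mul_add, mul_div_cancel₀ _ hη.ne']; linarith⟩)
  have hw := weight_extend_le (η := η) (H := H) (s := s) (c := c) {(x.castSucc, c), (c, y.castSucc)}
    (by simp [hx.le, hy.le]) (by
      rintro i j (rfl | rfl) hij hk
      · have : j = y.castSucc := by
          apply hs
          rcases hk y.castSucc with h1 | h1 <;> rcases hcons₂ j with h2 | h2 <;> linarith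
        simp [this]
      · have : i = x.castSucc := by
          apply hs
          rcases hk x.castSucc with h1 | h1 <;> rcases hcons₁ i with h2 | h2 <;> linarith
        simp [this])
  have hne : (x.castSucc, c) ≠ (c, y.castSucc) := by
    intro he
    exact hx.ne (congrArg s (Prod.ext_iff.1 he).1)
  rw [Finset.sum_pair hne, hH, weight_map] at hw
  replace hw : weight s (extend η s c H) ≤ weight (Fin.init s) G + _ := hw
  beta_reduce at hw
  obtain ⟨i, j, hij, hD⟩ := h.diam (Fin.pos x)
  refine ⟨_, _, h.snoc (p := s c - s x.castSucc) (q := s y.castSucc - s c) le_extend x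
    ⟨?_, ?_⟩ hkp hkp' hkq hkq' (fun _ => ?_) (fun _ => ?_) ?_ ?_⟩
  · rw [Fin.forall_fin_succ']
    simp only [Fin.snoc_castSucc, Fin.snoc_last]
    refine ⟨fun i => ?_, ?_⟩
    · rcases eq_or_ne i x with rfl | hi
      · simpa using hcons₁
      · rw [Fin.forall_fin_succ']
        simp only [Function.update_of_ne hi]
        refine ⟨hsep i, ?_⟩
        have hne : s i.castSucc ≠ s x.castSucc := fun he => hi (Fin.castSucc_injective n (hs he))
        rcases hcons₁ i.castSucc with h1 | h1
        · rcases hsep i x with h2 | h2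
          · exact absurd (le_antisymm h1 h2) hne
          · exact Or.inr (by linarith)
        · exact Or.inl h1
    · simpa only [← hc, add_sub_cancel] using hcons₂
  · rw [Fin.forall_fin_succ']
    simp only [Fin.snoc_castSucc, Fin.snoc_last]
    refine ⟨fun i => ?_, Or.inr ⟨by linarith, y.castSucc, by ring⟩⟩
    rcases eq_or_ne i x with rfl | hi
    · exact Or.inr ⟨by simpa using hx, c, by simp⟩
    · simp only [Function.update_of_ne hi]
      rcases h.gap.next i with ⟨h0, h1⟩ | ⟨h0, j, hj⟩
      · refine Or.inl ⟨h0, ?_⟩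
        rw [Fin.forall_fin_succ']
        exact ⟨h1, hy.le.trans (h1 y)⟩
      · exact Or.inr ⟨h0, j.castSucc, hj⟩
  · simpa only [add_sub_cancel] using hcp
  · simpa only [← hc, add_sub_cancel] using hcq
  · have hL : g x = (s c - s x.castSucc) + (s y.castSucc - s c) := by linarith
    have hz : ∑ i, g i - g x + (s c - s x.castSucc) + (s y.castSucc - s c) = ∑ i, g i := by
      linarith
    rw [hz, hL]
    have hp0 := sub_pos.2 hx
    have hq0 := sub_pos.2 hy
    generalize s c - s x.castSucc = p at *
    generalize s y.castSucc - s c = q at *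
    -- The shorter part is charged its length, the longer one the minimum of its length and `E`. The
    -- released credit `k x` cancels against the one in `E`.
    rcases le_total p q with hpq | hpq
    · have key := add_min_le_entropy hη hη1 hp0 hpq
      rcases min_cases q (p / η) with ⟨h1, -⟩ | ⟨h1, -⟩ <;> rw [h1] at key <;> linarith
    · have key := add_min_le_entropy hη hη1 hq0 hpq
      rw [add_comm q p] at key
      rcases min_cases p (q / η) with ⟨h1, -⟩ | ⟨h1, -⟩ <;> rw [h1] at key <;> linarith
  · refine ⟨i.castSucc, j.castSucc, ?_, ?_⟩
    · rw [Fin.forall_fin_succ']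
      exact ⟨hij, (hij x).1.trans hx.le, hy.le.trans (hij y).2⟩
    · change _ = s j.castSucc - s i.castSucc at hD
      linarith

/-- A new rightmost point. -/
lemma Certificate.insert_right (hs : Function.Injective s) (hη : 0 < η) (hM : 0 ≤ M)
    (h : Certificate η M (Fin.init s) G g k) {x : Fin n} (hx : ∀ i : Fin n, s i.castSucc ≤ s x.castSucc)
    (hxc : s x.castSucc < s (Fin.last n)) :
    ∃ g' k', Certificate η M s (extend η s (Fin.last n) (G.map Fin.castSuccEmb)) g' k' := by
  classical
  set c := Fin.last n with hc
  set H := G.map Fin.castSuccEmb with hH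
  have hgx : g x = 0 := by
    rcases h.gap.next x with h' | ⟨h0, j, hj⟩
    · exact h'.1
    · have : s j.castSucc ≤ s x.castSucc := hx j
      change s j.castSucc = s x.castSucc + g x at hj
      linarith
  have hkx : k x = 0 := le_antisymm (hgx ▸ h.le_gap x) (h.nonneg x)
  have hcons : ∀ l, s l ≤ s x.castSucc ∨ s c ≤ s l := by
    rw [Fin.forall_fin_succ']
    exact ⟨fun l => Or.inl (hx l), Or.inr le_rfl⟩
  have hmax : ∀ l, s l ≤ s c := by
    rw [Fin.forall_fin_succ']
    exact ⟨fun l => (hx l).trans hxc.le, le_rfl⟩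
  -- No old edge reaches `c`. With `E` equal to the new length its hypothesis is vacuous, and the
  -- charge is absorbed by the growth of `∑ i, g i`.
  obtain ⟨kp, hkp, hkp', hcp, hp, -⟩ := exists_credit (G := extend η s c H) hη.le le_extend hxc
    (extend_adj (Or.inr rfl) hxc hcons) (E := s c - s x.castSucc) (by linarith)
    (fun h => absurd h (lt_irrefl _))
  have hw := weight_extend_le (η := η) (H := H) (s := s) (c := c) {(x.castSucc, c)}
    (by simp [hxc.le]) (by
      rintro i j (rfl | rfl) hij hk
      · exact absurd (hmax j) (not_le.2 hij)
      · have : i = x.castSucc := by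
          apply hs
          rcases hk x.castSucc with h1 | h1 <;> rcases hcons i with h2 | h2 <;> linarith
        simp [this])
  rw [Finset.sum_singleton, hH, weight_map] at hw
  replace hw : weight s (extend η s c H) ≤ weight (Fin.init s) G + _ := hw
  beta_reduce at hw
  obtain ⟨i, j, hij, hD⟩ := h.diam (Fin.pos x)
  refine ⟨_, _, h.snoc (p := s c - s x.castSucc) (q := 0) (kq := 0) le_extend x
    ⟨?_, ?_⟩ hkp hkp' le_rfl le_rfl (fun _ => ?_) (fun h0 => absurd h0 (lt_irrefl _)) ?_ ?_⟩
  · rw [Fin.forall_fin_succ']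
    simp only [Fin.snoc_castSucc, Fin.snoc_last]
    refine ⟨fun i => ?_, fun l => Or.inl (hmax l)⟩
    rcases eq_or_ne i x with rfl | hi
    · simpa using hcons
    · rw [Fin.forall_fin_succ']
      simp only [Function.update_of_ne hi]
      refine ⟨h.gap.sep i, Or.inr ?_⟩
      have hne : s i.castSucc ≠ s x.castSucc := fun he => hi (Fin.castSucc_injective n (hs he))
      have : s x.castSucc ≤ s i.castSucc ∨ s i.castSucc + g i ≤ s x.castSucc := h.gap.sep i x
      rcases this with h2 | h2
      · exact absurd (le_antisymm (hx i) h2) hne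
      · linarith
  · rw [Fin.forall_fin_succ']
    simp only [Fin.snoc_castSucc, Fin.snoc_last]
    refine ⟨fun i => ?_, Or.inl ⟨trivial, hmax⟩⟩
    rcases eq_or_ne i x with rfl | hi
    · exact Or.inr ⟨by simpa using hxc, c, by simp⟩
    · simp only [Function.update_of_ne hi]
      rcases h.gap.next i with ⟨h0, h1⟩ | ⟨h0, j, hj⟩
      · have hne : s i.castSucc ≠ s x.castSucc := fun he => hi (Fin.castSucc_injective n (hs he))
        exact absurd (le_antisymm (hx i) (h1 x)) hne
      · exact Or.inr ⟨h0, j.castSucc, hj⟩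
  · simpa only [add_sub_cancel] using hcp
  · have hsum : 0 ≤ ∑ i, g i := Finset.sum_nonneg fun i _ => h.gap.nonneg i
    have hent := negMulLog_add_le hsum (sub_nonneg.2 hxc.le)
    rw [hgx, hkx]
    simp only [Real.negMulLog_zero, sub_zero, add_zero]
    have := mul_nonneg hM (sub_nonneg.2 hent)
    linarith
  · refine ⟨i.castSucc, c, fun l => ⟨?_, hmax l⟩, ?_⟩
    · revert l
      rw [Fin.forall_fin_succ']
      exact ⟨fun l => (hij l).1, (hij x).1.trans hxc.le⟩
    · have h1 : s x.castSucc ≤ s j.castSucc := (hij x).2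
      have h2 := hx j
      change _ = s j.castSucc - s i.castSucc at hD
      linarith

/-- A new leftmost point. -/
lemma Certificate.insert_left (hs : Function.Injective s) (hη : 0 < η) (hM : 0 ≤ M)
    (h : Certificate η M (Fin.init s) G g k) {y : Fin n} (hy : ∀ i : Fin n, s y.castSucc ≤ s i.castSucc)
    (hyc : s (Fin.last n) < s y.castSucc) :
    ∃ g' k', Certificate η M s (extend η s (Fin.last n) (G.map Fin.castSuccEmb)) g' k' := by
  classical
  set c := Fin.last n with hc
  set H := G.map Fin.castSuccEmb with hH
  have hcons : ∀ l, s l ≤ s c ∨ s y.castSucc ≤ s l := by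
    rw [Fin.forall_fin_succ']
    exact ⟨fun l => Or.inr (hy l), Or.inl le_rfl⟩
  have hmin : ∀ l, s c ≤ s l := by
    rw [Fin.forall_fin_succ']
    exact ⟨fun l => hyc.le.trans (hy l), le_rfl⟩
  obtain ⟨kq, hkq, hkq', hcq, hq, -⟩ := exists_credit (G := extend η s c H) hη.le le_extend hyc
    (extend_adj (Or.inl rfl) hyc hcons) (E := s y.castSucc - s c) (by linarith)
    (fun h => absurd h (lt_irrefl _))
  have hw := weight_extend_le (η := η) (H := H) (s := s) (c := c) {(c, y.castSucc)}
    (by simp [hyc.le]) (by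
      rintro i j (rfl | rfl) hij hk
      · have : j = y.castSucc := by
          apply hs
          rcases hk y.castSucc with h1 | h1 <;> rcases hcons j with h2 | h2 <;> linarith
        simp [this]
      · exact absurd (hmin i) (not_le.2 hij))
  rw [Finset.sum_singleton, hH, weight_map] at hw
  replace hw : weight s (extend η s c H) ≤ weight (Fin.init s) G + _ := hw
  beta_reduce at hw
  obtain ⟨i, j, hij, hD⟩ := h.diam (Fin.pos y)
  -- The gap to the right of `y` is unchanged; the new gap belongs to `c`.
  refine ⟨_, _, h.snoc (p := g y) (q := s y.castSucc - s c) (kp := k y) le_extend y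
    ⟨?_, ?_⟩ (h.nonneg y) (h.le_gap y) hkq hkq' (fun h0 => ?_) (fun _ => ?_) ?_ ?_⟩
  · rw [Function.update_eq_self, Fin.forall_fin_succ']
    simp only [Fin.snoc_castSucc, Fin.snoc_last]
    refine ⟨fun i => ?_, by simpa only [← hc, add_sub_cancel] using hcons⟩
    rw [Fin.forall_fin_succ']
    exact ⟨h.gap.sep i, Or.inl (hmin _)⟩
  · rw [Function.update_eq_self, Fin.forall_fin_succ']
    simp only [Fin.snoc_castSucc, Fin.snoc_last]
    refine ⟨fun i => ?_, Or.inr ⟨by linarith, y.castSucc, by ring⟩⟩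
    rcases h.gap.next i with ⟨h0, h1⟩ | ⟨h0, j, hj⟩
    · refine Or.inl ⟨h0, ?_⟩
      rw [Fin.forall_fin_succ']
      exact ⟨h1, hmin _⟩
    · exact Or.inr ⟨h0, j.castSucc, hj⟩
  · obtain ⟨a, b, hab, hh⟩ := h.cover y h0
    exact ⟨a.castSucc, b.castSucc, le_extend (SimpleGraph.map_adj_apply.2 hab), hh⟩
  · simpa only [← hc, add_sub_cancel] using hcq
  · have hsum : 0 ≤ ∑ i, g i := Finset.sum_nonneg fun i _ => h.gap.nonneg i
    have hent := negMulLog_add_le hsum (sub_nonneg.2 hyc.le)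
    have := mul_nonneg hM (sub_nonneg.2 hent)
    rw [sub_add_cancel]
    linarith
  · refine ⟨c, j.castSucc, fun l => ⟨hmin l, ?_⟩, ?_⟩
    · revert l
      rw [Fin.forall_fin_succ']
      exact ⟨fun l => (hij l).2, hyc.le.trans (hij y).2⟩
    · have h1 : s i.castSucc ≤ s y.castSucc := (hij y).1
      have h2 := hy i
      change _ = s j.castSucc - s i.castSucc at hD
      linarith

lemma Certificate.extend (hs : Function.Injective s) (hη : 0 < η) (hη1 : η < 1)
    (h : Certificate η (4 / (η * Real.log η⁻¹)) (Fin.init s) G g k) :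
    ∃ g' k', Certificate η (4 / (η * Real.log η⁻¹)) s
      (extend η s (Fin.last n) (G.map Fin.castSuccEmb)) g' k' := by
  classical
  have hM : 0 ≤ 4 / (η * Real.log η⁻¹) := by
    have := Real.log_pos ((one_lt_inv₀ hη).2 hη1)
    positivity
  by_cases hL : ∃ i : Fin n, s i.castSucc < s (Fin.last n)
  · obtain ⟨x, hx, hmax⟩ := Finset.exists_max_image
      (Finset.univ.filter fun i : Fin n => s i.castSucc < s (Fin.last n)) (fun i => s i.castSucc)
      (by obtain ⟨i, hi⟩ := hL; exact ⟨i, by simpa using hi⟩)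
    simp only [Finset.mem_filter, Finset.mem_univ, true_and] at hx hmax
    rcases h.gap.next x with ⟨-, h1⟩ | ⟨h0, y, hy⟩
    · exact h.insert_right hs hη hM h1 hx
    · refine h.insert_between hs hη hη1 hy hx ?_
      by_contra! hcon
      have hne : s y.castSucc ≠ s (Fin.last n) :=
        fun he => (Fin.castSucc_lt_last y).ne (hs he)
      have := hmax y (lt_of_le_of_ne hcon hne)
      change s y.castSucc = s x.castSucc + g x at hy
      linarith
  · push Not at hL
    rcases n.eq_zero_or_pos with rfl | hn
    · have : Subsingleton (Fin (0 + 1)) := Fin.subsingleton_one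
      refine ⟨0, 0, ⟨fun i l => Or.inl ?_, fun i => Or.inl ⟨rfl, fun l => ?_⟩⟩, by simp, by simp,
        by simp, ?_, fun _ => ⟨0, 0, ?_, by simp⟩⟩
      · rw [Subsingleton.elim i l]
      · rw [Subsingleton.elim i l]
      · have := weight_le_sum s
          (G := OnlineSpanner.extend η s (Fin.last 0) (G.map Fin.castSuccEmb)) ∅ (by
          intro e
          induction e with | _ i j =>
          intro hij
          exact absurd (Subsingleton.elim i j) (SimpleGraph.mem_edgeSet _ |>.1 hij).ne)
        simpa using this
      · intro l
        rw [Subsingleton.elim l 0]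
        exact ⟨le_rfl, le_rfl⟩
    · obtain ⟨y, -, hy⟩ := Finset.exists_min_image (Finset.univ : Finset (Fin n))
        (fun i => s i.castSucc) ⟨⟨0, hn⟩, Finset.mem_univ _⟩
      refine h.insert_left hs hη hM (fun i => hy i (Finset.mem_univ i)) (lt_of_le_of_ne (hL y) ?_)
      exact fun he => (Fin.castSucc_lt_last y).ne (hs he).symm

end Insert

/-! ### Competitive ratio of the greedy algorithm -/

lemma exists_certificate {η : ℝ} (hη : 0 < η) (hη1 : η < 1) (n : ℕ) (s : Fin n → ℝ)
    (hs : Function.Injective s) :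
    ∃ g k, Certificate η (4 / (η * Real.log η⁻¹)) s (greedy η n s) g k := by
  induction n with
  | zero =>
    refine ⟨0, 0, ⟨fun i => i.elim0, fun i => i.elim0⟩, by simp, by simp, by simp, ?_, by simp⟩
    have := weight_le_sum s (G := greedy η 0 s) ∅ (by
      intro e
      induction e with | _ i j => exact i.elim0)
    simpa using this
  | succ n ih =>
    obtain ⟨g, k, h⟩ := ih (Fin.init s) (hs.comp (Fin.castSucc_injective n))
    exact h.extend hs hη hη1

lemma isSpanner_greedy {ε : ℝ} (hε : 0 < ε) (hε1 : ε < 1) (n : ℕ) (s : Fin n → ℝ)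
    (hs : Function.Injective s) : IsSpanner (1 + ε) s (greedy (ε / 3) n s) := by
  obtain ⟨g, k, h⟩ := exists_certificate (η := ε / 3) (by linarith) (by linarith) n s hs
  refine h.gap.isSpanner hs hε hε1 fun i hi => ?_
  obtain ⟨a, b, hab, ha, hb, hlen⟩ := h.cover i hi
  refine ⟨a, b, hab, ha, hb, hlen.trans ?_⟩
  have := h.le_gap i
  nlinarith

/-- The lazy greedy online algorithm: join each new point to its two neighbours, unless the gap
between them lies below an edge that is hardly longer. -/
noncomputable def greedyAlgorithm {ε : ℝ} (hε : 0 < ε) (hε1 : ε < 1) : OnlineAlgorithm ℝ (1 + ε) where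
  graph := greedy (ε / 3)
  isSpanner := isSpanner_greedy hε hε1
  mono _ _ _ := le_extend

/-- In `14 = 12 + 2`, the 12 is `4/η` with `η = ε/3`; the 2 absorbs the additive diameter, as `log n
≥ 1/2` and `ε⁻¹ ≥ log ε⁻¹`. -/
lemma competitiveRatio_greedyAlgorithm_le {ε : ℝ} (hε : 0 < ε) (hε1 : ε < 1) {n : ℕ} (hn : 2 ≤ n) :
    competitiveRatio (greedyAlgorithm hε hε1) n ≤
      ENNReal.ofReal (14 * (ε⁻¹ * Real.log n / Real.log ε⁻¹)) := by
  refine iSup₂_le fun s hs => ENNReal.ofReal_le_ofReal ?_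
  obtain ⟨g, k, h⟩ := exists_certificate (η := ε / 3) (by linarith) (by linarith) n s hs
  have hspan := isSpanner_greedy hε hε1 n s hs
  obtain ⟨i, j, hij, hD⟩ := h.diam (by lia)
  have hD0 : 0 < ∑ i, g i := by
    rw [hD, sub_pos]
    refine lt_of_le_of_ne (hij i).2 fun he => ?_
    have : (⟨0, by lia⟩ : Fin n) = ⟨1, by lia⟩ := hs <| by
      have h0 := hij ⟨0, by lia⟩
      have h1 := hij ⟨1, by lia⟩
      linarith
    simp at this
  have hopt : ∑ i, g i ≤ optWeight (1 + ε) s := by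
    have := dist_le_optWeight hspan j i
    rwa [Real.dist_eq, ← hD, abs_of_pos hD0] at this
  change weight s (greedy (ε / 3) n s) / _ ≤ _
  have hlog : 0 < Real.log ε⁻¹ := Real.log_pos ((one_lt_inv₀ hε).2 hε1)
  have hlog3 : Real.log ε⁻¹ ≤ Real.log (ε / 3)⁻¹ := by
    refine Real.log_le_log (by positivity) ?_
    gcongr
    linarith
  have hlogn : 1 / 2 ≤ Real.log n := by
    have : Real.log 2 ≤ Real.log n := Real.log_le_log (by norm_num) (by exact_mod_cast hn)
    linarith [Real.log_two_gt_d9]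
  set D := ∑ i, g i
  have hone : 1 ≤ ε⁻¹ / Real.log ε⁻¹ := by
    rw [one_le_div hlog]
    linarith [Real.log_le_sub_one_of_pos (show 0 < ε⁻¹ by positivity)]
  have hM : 4 / (ε / 3 * Real.log (ε / 3)⁻¹) ≤ 12 * (ε⁻¹ / Real.log ε⁻¹) := by
    calc 4 / (ε / 3 * Real.log (ε / 3)⁻¹) ≤ 4 / (ε / 3 * Real.log ε⁻¹) := by gcongr
      _ = 12 * (ε⁻¹ / Real.log ε⁻¹) := by field_simp; norm_num
  have hB : 0 ≤ 14 * (ε⁻¹ * Real.log n / Real.log ε⁻¹) := by positivity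
  rw [div_le_iff₀ (hD0.trans_le hopt)]
  refine le_trans ?_ (mul_le_mul_of_nonneg_left hopt hB)
  have h1 := h.weight_le
  have h2 : 0 ≤ ∑ i, k i := Finset.sum_nonneg fun i _ => h.nonneg i
  have h3 := sum_negMulLog_sub_le (by lia : 0 < n) g h.gap.nonneg
  have hM0 : 0 ≤ 4 / (ε / 3 * Real.log (ε / 3)⁻¹) := by
    have := hlog.trans_le hlog3
    positivity
  have h4 := mul_le_mul_of_nonneg_left h3 hM0
  have h5 : 4 / (ε / 3 * Real.log (ε / 3)⁻¹) * (D * Real.log n) ≤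
      12 * (ε⁻¹ / Real.log ε⁻¹) * (D * Real.log n) := by gcongr
  have h6 : D ≤ 2 * (ε⁻¹ / Real.log ε⁻¹) * (D * Real.log n) := by
    have : 1 ≤ 2 * (ε⁻¹ / Real.log ε⁻¹) * Real.log n := by nlinarith
    nlinarith
  have h7 : 14 * (ε⁻¹ * Real.log n / Real.log ε⁻¹) * D =
      14 * (ε⁻¹ / Real.log ε⁻¹) * (D * Real.log n) := by ring
  linarith

/-! ### Forced edges -/

section Forcing

variable {ε : ℝ}

/-- A new point `c` whose left gap is not too short compared with its right gap forces an edge at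
`c` that is at least as long as the right gap. -/
lemma weight_add_le_of_isSpanner {n : ℕ} {s : Fin (n + 1) → ℝ} {G : SimpleGraph (Fin n)}
    {H : SimpleGraph (Fin (n + 1))} (hGH : G.map Fin.castSuccEmb ≤ H) (hH : IsSpanner (1 + ε) s H)
    {l r : ℝ} (hr : 0 < r) (hl : 0 < l) (hlr : ε * r < 2 * l)
    (hnext : ∃ b : Fin n, s b.castSucc = s (Fin.last n) + r)
    (hsep : ∀ j : Fin n, s j.castSucc ≤ s (Fin.last n) - l ∨ s (Fin.last n) + r ≤ s j.castSucc) :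
    weight (Fin.init s) G + r ≤ weight s H := by
  obtain ⟨b, hb⟩ := hnext
  obtain ⟨p, -, hp⟩ := hH (Fin.last n) b.castSucc
  have hd : dist (s (Fin.last n)) (s b.castSucc) = r := by
    rw [hb, dist_comm, Real.dist_eq, add_sub_cancel_left, abs_of_pos hr]
  rw [hd] at hp
  obtain ⟨v, hcv, hv⟩ : ∃ v : Fin n, H.Adj (Fin.last n) v.castSucc ∧
      dist (s (Fin.last n)) (s v.castSucc) + dist (s v.castSucc) (s b.castSucc) ≤
        (1 + ε) * r := by
    obtain ⟨v, h, q, rfl⟩ := p.exists_eq_cons_of_ne (Fin.castSucc_lt_last b).ne'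
    rw [walkLength_cons] at hp
    obtain ⟨v, rfl⟩ := Fin.exists_castSucc_eq.2 h.ne.symm
    exact ⟨v, h, by linarith [dist_le_walkLength s q]⟩
  -- A first step to the left gives length at least `2 l + r > (1 + ε) r`, so `v` is at or beyond
  -- the right neighbour.
  have hrv : r ≤ dist (s (Fin.last n)) (s v.castSucc) := by
    rcases hsep v with h | h
    · rw [Real.dist_eq, Real.dist_eq, hb, abs_of_nonneg (by linarith),
        abs_of_nonpos (by linarith)] at hv
      linarith
    · rw [dist_comm, Real.dist_eq, abs_of_nonneg (by linarith)]
      linarith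
  have hnot : ¬ (G.map Fin.castSuccEmb).Adj (Fin.last n) v.castSucc := by
    rintro ⟨-, a, -, -, ha, -⟩
    exact (Fin.castSucc_lt_last a).ne ha
  have := weight_add_edgeLength_le s hGH hcv hnot
  rw [weight_map] at this
  change weight (Fin.init s) G + _ ≤ _ at this
  linarith

variable {s l r : ℕ → ℝ}

lemma injective_of_sep (hr : ∀ i, 0 < r i) (hl : ∀ i, 0 < l i)
    (hsep : ∀ i, ∀ j ≤ i, s j ≤ s (i + 1) - l i ∨ s (i + 1) + r i ≤ s j) :
    Function.Injective s := by
  have key : ∀ i j, i < j → s i ≠ s j := by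
    intro i j hij he
    obtain ⟨j, rfl⟩ := Nat.exists_eq_succ_of_ne_zero (by lia : j ≠ 0)
    have := hr j
    have := hl j
    rcases hsep j i (by lia) with h | h <;> rw [he] at h <;> linarith
  intro i j he
  rcases lt_trichotomy i j with h | h | h
  · exact absurd he (key i j h)
  · exact h
  · exact absurd he.symm (key j i h)

/-- Each forced edge ends at the point just inserted, so it is new and the lengths add up. -/
lemma sum_le_weight_graph (A : OnlineAlgorithm ℝ (1 + ε)) (hr : ∀ i, 0 < r i) (hl : ∀ i, 0 < l i)
    (hlr : ∀ i, ε * r i < 2 * l i) (hnext : ∀ i, ∃ j ≤ i, s j = s (i + 1) + r i)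
    (hsep : ∀ i, ∀ j ≤ i, s j ≤ s (i + 1) - l i ∨ s (i + 1) + r i ≤ s j) (n : ℕ) :
    ∑ i ∈ Finset.range n, r i ≤
      weight (fun i : Fin (n + 1) => s i) (A.graph (n + 1) fun i => s i) := by
  have hs := injective_of_sep hr hl hsep
  induction n with
  | zero => simpa using weight_nonneg _ _
  | succ n ih =>
    rw [Finset.sum_range_succ]
    have hinj : Function.Injective fun i : Fin (n + 1 + 1) => s i := hs.comp Fin.val_injective
    have := weight_add_le_of_isSpanner (s := fun i : Fin (n + 1 + 1) => s i)
      (A.mono (n + 1) _ hinj) (A.isSpanner _ _ hinj) (hr n) (hl n) (hlr n)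
      (by
        obtain ⟨j, hj, he⟩ := hnext n
        exact ⟨⟨j, by lia⟩, he⟩)
      (fun j => hsep n j (by lia))
    exact (add_le_add_left ih _).trans this

end Forcing

/-! ### The hard sequence -/

section Digits

variable {m : ℕ}

/-- The points of the lower bound: for `i` with leading digit `v` and remaining digits `u` in base
`m`, the `v`-th of the `m - 1` points that divide the interval `[u / m ^ k, (u + 1) / m ^ k]`. -/
noncomputable def digitPoint (m i : ℕ) : ℝ :=
  ((i % m ^ Nat.log m i * m + i / m ^ Nat.log m i : ℕ) : ℝ) / (m : ℝ) ^ (Nat.log m i + 1)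

/-- The distance from `digitPoint m i` to its right neighbour among the earlier points and `1`. -/
noncomputable def rightGap (m i : ℕ) : ℝ :=
  (m - (i / m ^ Nat.log m i : ℕ)) / (m : ℝ) ^ (Nat.log m i + 1)

/-- A lower bound for the distance from `digitPoint m i` to the earlier points on its left. -/
noncomputable def leftGap (m i : ℕ) : ℝ := 1 / (m : ℝ) ^ (Nat.log m i + 1)

/-- The sequence of the lower bound. -/
noncomputable def hardSequence (m : ℕ) : ℕ → ℝ
  | 0 => 1
  | i + 1 => digitPoint m i

lemma div_pow_log_lt (hm : 1 < m) (i : ℕ) : i / m ^ Nat.log m i < m := by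
  rw [Nat.div_lt_iff_lt_mul (by positivity), mul_comm, ← pow_succ]
  exact Nat.lt_pow_succ_log_self hm i

lemma div_pow_log_pos (hm : 1 < m) {i : ℕ} (hi : i ≠ 0) : 0 < i / m ^ Nat.log m i :=
  Nat.div_pos (Nat.pow_log_le_self m hi) (by positivity)

lemma digitPoint_mul_add (hm : 1 < m) {k u v : ℕ} (hu : u < m ^ k) (hv : 0 < v) (hvm : v < m) :
    digitPoint m (v * m ^ k + u) = ((u * m + v : ℕ) : ℝ) / (m : ℝ) ^ (k + 1) := by
  have hlog : Nat.log m (v * m ^ k + u) = k := by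
    refine Nat.log_eq_of_pow_le_of_lt_pow ?_ ?_
    · nlinarith
    · rw [pow_succ]
      have : (v + 1) * m ^ k ≤ m * m ^ k := Nat.mul_le_mul_right _ hvm
      lia
  rw [digitPoint, hlog, mul_comm v, Nat.mul_add_mod, Nat.mod_eq_of_lt hu,
    Nat.mul_add_div (by positivity), Nat.div_eq_of_lt hu, add_zero]

lemma exists_digitPoint_eq_div (hm : 1 < m) {j k : ℕ} (hj : j < m ^ k) :
    ∃ w : ℕ, digitPoint m j = (w : ℝ) / (m : ℝ) ^ k := by
  rcases eq_or_ne j 0 with rfl | hj0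
  · exact ⟨0, by simp [digitPoint]⟩
  have hk : Nat.log m j + 1 ≤ k := Nat.log_lt_of_lt_pow hj0 hj
  refine ⟨(j % m ^ Nat.log m j * m + j / m ^ Nat.log m j) * m ^ (k - (Nat.log m j + 1)), ?_⟩
  have hm0 : (0 : ℝ) < m := by exact_mod_cast (by lia : 0 < m)
  rw [digitPoint, div_eq_div_iff (by positivity) (by positivity), Nat.cast_mul, mul_assoc,
    Nat.cast_pow, ← pow_add, Nat.sub_add_cancel hk]

/-- The last digit of `w` becomes the leading digit of the index; if it is zero, a coarser grid
already has the point. This supplies the right neighbours. -/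
lemma exists_digitPoint_eq (hm : 1 < m) {k w : ℕ} (hw : w < m ^ k) :
    ∃ j < m ^ k, digitPoint m j = (w : ℝ) / (m : ℝ) ^ k := by
  have hm0 : (0 : ℝ) < m := by exact_mod_cast (by lia : 0 < m)
  induction k generalizing w with
  | zero =>
    obtain rfl : w = 0 := by simpa using hw
    exact ⟨0, by simp, by simp [digitPoint]⟩
  | succ k ih =>
    have hu : w / m < m ^ k := by
      rw [Nat.div_lt_iff_lt_mul (by lia), ← pow_succ]
      exact hw
    have hpow : m ^ k ≤ m ^ (k + 1) := Nat.pow_le_pow_right (by lia) (by lia)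
    rcases Nat.eq_zero_or_pos (w % m) with h0 | hpos
    · obtain ⟨j, hj, he⟩ := ih hu
      refine ⟨j, hj.trans_le hpow, ?_⟩
      have hw' : (w : ℝ) = (w / m : ℕ) * m := by
        exact_mod_cast (Nat.div_mul_cancel (Nat.dvd_of_mod_eq_zero h0)).symm
      rw [he, hw', pow_succ]
      field_simp
    · have hvm : w % m < m := Nat.mod_lt _ (by lia)
      refine ⟨w % m * m ^ k + w / m, ?_, ?_⟩
      · rw [pow_succ]
        have : (w % m + 1) * m ^ k ≤ m * m ^ k := Nat.mul_le_mul_right _ hvm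
        lia
      · rw [digitPoint_mul_add hm hu hpos hvm, Nat.div_add_mod']

/-- In units of `m^-(k+1)`, points of earlier levels sit at multiples of `m`. Within level `k`,
indices are ordered by leading digit first, so earlier points of the same interval have a smaller
digit and lie to the left. -/
lemma digitPoint_sep (hm : 1 < m) {i j : ℕ} (hij : j < i) :
    digitPoint m j ≤ digitPoint m i - leftGap m i ∨
      digitPoint m i + rightGap m i ≤ digitPoint m j := by
  have hm0 : (0 : ℝ) < m := by exact_mod_cast (by lia : 0 < m)
  have hv := div_pow_log_lt hm i
  have hv0 := div_pow_log_pos hm (by lia : i ≠ 0)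
  have hi := Nat.div_add_mod' i (m ^ Nat.log m i)
  simp only [digitPoint, leftGap, rightGap]
  set k := Nat.log m i
  have hu : i % m ^ k < m ^ k := Nat.mod_lt _ (by positivity)
  generalize i / m ^ k = v at *
  generalize i % m ^ k = u at *
  obtain ⟨Q, hQ, h⟩ : ∃ Q : ℕ, digitPoint m j = (Q : ℝ) / (m : ℝ) ^ (k + 1) ∧
      (Q + 1 ≤ u * m + v ∨ u * m + m ≤ Q) := by
    rcases lt_or_ge j (m ^ k) with hj | hj
    · obtain ⟨w, hw⟩ := exists_digitPoint_eq_div hm hj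
      refine ⟨w * m, ?_, ?_⟩
      · rw [hw, pow_succ]
        push_cast
        field_simp
      · rcases le_or_gt w u with h | h
        · left
          have := Nat.mul_le_mul_right m h
          lia
        · right
          have := Nat.mul_le_mul_right m (Nat.succ_le_of_lt h)
          lia
    · have hv' : 0 < j / m ^ k := Nat.div_pos hj (by positivity)
      have hu' : j % m ^ k < m ^ k := Nat.mod_lt _ (by positivity)
      have hj' := Nat.div_add_mod' j (m ^ k)
      generalize j / m ^ k = v' at *
      generalize j % m ^ k = u' at *
      have hle : v' ≤ v := by
        by_contra! hcon
        have := Nat.mul_le_mul_right (m ^ k) (Nat.succ_le_of_lt hcon)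
        lia
      refine ⟨u' * m + v', ?_, ?_⟩
      · rw [← hj', digitPoint_mul_add hm hu' hv' (by lia)]
      · rcases lt_trichotomy u' u with h | rfl | h
        · left
          have := Nat.mul_le_mul_right m (Nat.succ_le_of_lt h)
          lia
        · left
          have : v' ≠ v := by
            rintro rfl
            lia
          lia
        · right
          have := Nat.mul_le_mul_right m (Nat.succ_le_of_lt h)
          lia
  change digitPoint m j ≤ _ ∨ _ ≤ digitPoint m j
  rw [hQ, ← sub_div, ← add_div]
  rcases h with h | h
  · left
    gcongr
    rw [le_sub_iff_add_le]
    exact_mod_cast h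
  · right
    gcongr
    have : ((u * m + m : ℕ) : ℝ) ≤ Q := by exact_mod_cast h
    push_cast at this ⊢
    linarith

lemma leftGap_pos (hm : 1 < m) (i : ℕ) : 0 < leftGap m i := by
  have hm0 : (0 : ℝ) < m := by exact_mod_cast (by lia : 0 < m)
  unfold leftGap
  positivity

lemma rightGap_pos (hm : 1 < m) (i : ℕ) : 0 < rightGap m i := by
  have hm0 : (0 : ℝ) < m := by exact_mod_cast (by lia : 0 < m)
  refine div_pos (sub_pos.2 ?_) (by positivity)
  exact_mod_cast div_pow_log_lt hm i

lemma mul_rightGap_lt {ε : ℝ} (hε : 0 ≤ ε) (hm : 1 < m) (hεm : ε * m < 2) (i : ℕ) :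
    ε * rightGap m i < 2 * leftGap m i := by
  have hm0 : (0 : ℝ) < m := by exact_mod_cast (by lia : 0 < m)
  unfold rightGap leftGap
  rw [← mul_div_assoc, ← mul_div_assoc, mul_one]
  gcongr
  rw [mul_sub]
  have : 0 ≤ ε * (i / m ^ Nat.log m i : ℕ) := by positivity
  linarith

lemma digitPoint_add_rightGap (hm : 1 < m) (i : ℕ) : digitPoint m i + rightGap m i =
    ((i % m ^ Nat.log m i + 1 : ℕ) : ℝ) / (m : ℝ) ^ Nat.log m i := by
  have hm0 : (0 : ℝ) < m := by exact_mod_cast (by lia : 0 < m)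
  rw [digitPoint, rightGap, ← add_div, pow_succ]
  push_cast
  field_simp
  ring

lemma digitPoint_nonneg (m i : ℕ) : 0 ≤ digitPoint m i := by
  unfold digitPoint
  positivity

lemma digitPoint_add_rightGap_le_one (hm : 1 < m) (i : ℕ) :
    digitPoint m i + rightGap m i ≤ 1 := by
  have hm0 : (0 : ℝ) < m := by exact_mod_cast (by lia : 0 < m)
  rw [digitPoint_add_rightGap hm, div_le_one (by positivity)]
  exact_mod_cast Nat.mod_lt _ (by positivity)

lemma hardSequence_mem (hm : 1 < m) (i : ℕ) : 0 ≤ hardSequence m i ∧ hardSequence m i ≤ 1 := by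
  cases i with
  | zero => simp [hardSequence]
  | succ i =>
    exact ⟨digitPoint_nonneg m i,
      by linarith! [digitPoint_add_rightGap_le_one hm i, rightGap_pos hm i]⟩

lemma hardSequence_sep (hm : 1 < m) (i j : ℕ) (hj : j ≤ i) :
    hardSequence m j ≤ hardSequence m (i + 1) - leftGap m i ∨
      hardSequence m (i + 1) + rightGap m i ≤ hardSequence m j := by
  cases j with
  | zero => exact Or.inr (digitPoint_add_rightGap_le_one hm i)
  | succ j => exact digitPoint_sep hm hj

lemma hardSequence_next (hm : 1 < m) (i : ℕ) :
    ∃ j ≤ i, hardSequence m j = hardSequence m (i + 1) + rightGap m i := by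
  have hm0 : (0 : ℝ) < m := by exact_mod_cast (by lia : 0 < m)
  change ∃ j ≤ i, hardSequence m j = digitPoint m i + rightGap m i
  rw [digitPoint_add_rightGap hm]
  have hu : i % m ^ Nat.log m i + 1 ≤ m ^ Nat.log m i := Nat.mod_lt _ (by positivity)
  rcases hu.eq_or_lt with h | h
  · refine ⟨0, by lia, ?_⟩
    rw [h, Nat.cast_pow, div_self (by positivity)]
    rfl
  · obtain ⟨j, hj, he⟩ := exists_digitPoint_eq hm h
    refine ⟨j + 1, ?_, he⟩
    rcases eq_or_ne i 0 with rfl | hi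
    · simp at h
    · exact hj.trans_le (Nat.pow_log_le_self m hi)

lemma sum_range_sub (c : ℝ) (d : ℕ) :
    ∑ i ∈ Finset.range d, (c - i) = c * d - d * (d - 1) / 2 := by
  induction d with
  | zero => simp
  | succ d ih =>
    rw [Finset.sum_range_succ, ih]
    push_cast
    ring

/-- Dropping the floor in the leading digit leaves an arithmetic progression with sum at least
`(m-1)²/(2m)`, and `m ≥ 2`. -/
lemma le_sum_rightGap_level (hm : 1 < m) (k : ℕ) :
    ((m : ℝ) - 1) / 4 ≤ ∑ i ∈ Finset.Ico (m ^ k) (m ^ (k + 1)), rightGap m i := by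
  have hm1 : (1 : ℝ) < m := by exact_mod_cast hm
  have hm2 : (2 : ℝ) ≤ m := by exact_mod_cast hm
  have hM : (0 : ℝ) < (m : ℝ) ^ k := by positivity
  have hle : m ^ k ≤ m ^ (k + 1) := Nat.pow_le_pow_right (by lia) (by lia)
  have hterm : ∀ i ∈ Finset.Ico (m ^ k) (m ^ (k + 1)),
      ((m : ℝ) ^ (k + 1) - i) / ((m : ℝ) ^ k * (m : ℝ) ^ (k + 1)) ≤ rightGap m i := by
    intro i hi
    obtain ⟨h1, h2⟩ := Finset.mem_Ico.1 hi
    rw [rightGap, Nat.log_eq_of_pow_le_of_lt_pow h1 h2, ← div_div]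
    gcongr
    rw [sub_div, pow_succ, mul_div_cancel_left₀ _ hM.ne']
    gcongr
    exact_mod_cast (Nat.cast_div_le (α := ℝ) (m := i) (n := m ^ k))
  refine le_trans ?_ (Finset.sum_le_sum hterm)
  rw [← Finset.sum_div, Finset.sum_Ico_eq_sum_range, le_div_iff₀ (by positivity)]
  have hd : ((m ^ (k + 1) - m ^ k : ℕ) : ℝ) = (m : ℝ) ^ (k + 1) - (m : ℝ) ^ k := by
    rw [Nat.cast_sub hle]
    push_cast
    rfl
  have hsum : ∑ i ∈ Finset.range (m ^ (k + 1) - m ^ k), ((m : ℝ) ^ (k + 1) - ((m ^ k + i : ℕ) : ℝ))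
      = ∑ i ∈ Finset.range (m ^ (k + 1) - m ^ k), (((m : ℝ) ^ (k + 1) - (m : ℝ) ^ k) - i) :=
    Finset.sum_congr rfl fun i _ => by push_cast; ring
  rw [hsum, sum_range_sub, hd, pow_succ]
  generalize (m : ℝ) ^ k = x at *
  generalize (m : ℝ) = y at *
  nlinarith [mul_pos hM hM, mul_nonneg (mul_pos hM hM).le (mul_nonneg (sub_nonneg.2 hm1.le)
    (sub_nonneg.2 hm2)), mul_pos hM (sub_pos.2 hm1)]

lemma mul_le_sum_rightGap (hm : 1 < m) (K : ℕ) :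
    K * (((m : ℝ) - 1) / 4) ≤ ∑ i ∈ Finset.range (m ^ K), rightGap m i := by
  induction K with
  | zero => simpa using (rightGap_pos hm 0).le
  | succ K ih =>
    have hle : m ^ K ≤ m ^ (K + 1) := Nat.pow_le_pow_right (by lia) (by lia)
    rw [← Finset.sum_range_add_sum_Ico _ hle]
    push_cast
    linarith [le_sum_rightGap_level hm K]

end Digits

/-! ### Choice of parameters for the lower bound -/

section LowerBound

variable {ε : ℝ}

/-- The certificate of the greedy algorithm already contains the gaps; the value of `η` is
immaterial. -/
lemma exists_isGap {n : ℕ} (hn : 0 < n) (s : Fin n → ℝ) (hs : Function.Injective s) :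
    ∃ g i j, IsGap s g ∧ ∑ l, g l = s j - s i := by
  obtain ⟨g, k, h⟩ := exists_certificate (η := 1 / 2) (by norm_num) (by norm_num) n s hs
  obtain ⟨i, j, -, hij⟩ := h.diam hn
  exact ⟨g, i, j, h.gap, hij⟩

lemma sum_rightGap_le_competitiveRatio (hε : 0 < ε) (hε1 : ε < 1) {m : ℕ} (hm : 1 < m)
    (hεm : ε * m < 2) (A : OnlineAlgorithm ℝ (1 + ε)) {n : ℕ} (hn : 0 < n) :
    ENNReal.ofReal (∑ i ∈ Finset.range n, rightGap m i) ≤ competitiveRatio A (n + 1) := by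
  have hinj : Function.Injective (hardSequence m) :=
    injective_of_sep (rightGap_pos hm) (leftGap_pos hm) (hardSequence_sep hm)
  have hw := sum_le_weight_graph A (rightGap_pos hm) (leftGap_pos hm)
    (mul_rightGap_lt hε.le hm hεm) (hardSequence_next hm) (hardSequence_sep hm) n
  have hs : Function.Injective fun i : Fin (n + 1) => hardSequence m i :=
    hinj.comp Fin.val_injective
  refine le_trans (ENNReal.ofReal_le_ofReal ?_) (le_iSup₂ (f := fun (s : Fin (n + 1) → ℝ)
    (_ : Function.Injective s) => ENNReal.ofReal (weight s (A.graph (n + 1) s) /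
      optWeight (1 + ε) s)) (fun i => hardSequence m i) hs)
  have hpos : 0 < optWeight (1 + ε) fun i : Fin (n + 1) => hardSequence m i := by
    refine lt_of_lt_of_le ?_ (dist_le_optWeight (A.isSpanner _ _ hs) 0 (Fin.last n))
    refine dist_pos.2 fun he => ?_
    have := hs he
    rw [Fin.ext_iff] at this
    simp at this
    lia
  have hle : optWeight (1 + ε) (fun i : Fin (n + 1) => hardSequence m i) ≤ 1 := by
    obtain ⟨g, i, j, hg, hij⟩ := exists_isGap (Nat.succ_pos n) _ hs
    refine (hg.optWeight_le_sum hs hε hε1).trans ?_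
    rw [hij]
    linarith [(hardSequence_mem hm i).1, (hardSequence_mem hm j).2]
  rw [le_div_iff₀ hpos]
  refine le_trans ?_ hw
  exact mul_le_of_le_one_right (Finset.sum_nonneg fun i _ => (rightGap_pos hm i).le) hle

lemma log_le_competitiveRatio {ε₀ : ℝ} (hε₀ : 0 < ε₀) (hε₀1 : ε₀ < 1) (hε : 0 < ε) (hεε₀ : ε ≤ ε₀)
    (A : OnlineAlgorithm ℝ (1 + ε)) {n : ℕ} (hn : ε⁻¹ ≤ n) :
    ENNReal.ofReal (1 / (64 * (1 + Real.log 2 / Real.log ε₀⁻¹)) *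
      (ε⁻¹ * Real.log n / Real.log ε⁻¹)) ≤ competitiveRatio A n := by
  have hε1 : ε < 1 := hεε₀.trans_lt hε₀1
  have hl0 : 0 < Real.log ε₀⁻¹ := Real.log_pos ((one_lt_inv₀ hε₀).2 hε₀1)
  have hl : Real.log ε₀⁻¹ ≤ Real.log ε⁻¹ :=
    Real.log_le_log (by positivity) (inv_anti₀ hε hεε₀)
  have hl1 : 0 < Real.log ε⁻¹ := hl0.trans_le hl
  have hlog2 : 0 < Real.log 2 := Real.log_pos (by norm_num)
  have hx1 : 1 < ε⁻¹ := (one_lt_inv₀ hε).2 hε1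
  have hεx : ε * ε⁻¹ = 1 := mul_inv_cancel₀ hε.ne'
  set x := ε⁻¹
  set D := 1 + Real.log 2 / Real.log ε₀⁻¹ with hD
  have hD1 : 1 ≤ D := le_add_of_nonneg_right (by positivity)
  have h2D : Real.log 2 ≤ D * Real.log x := by
    calc Real.log 2 = Real.log 2 / Real.log ε₀⁻¹ * Real.log ε₀⁻¹ :=
        (div_mul_cancel₀ _ hl0.ne').symm
      _ ≤ D * Real.log x := by
        gcongr
        rw [hD]
        linarith
  have hn2 : 2 ≤ n := by
    have : (1 : ℝ) < n := hx1.trans_le hn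
    exact_mod_cast this
  obtain ⟨N, rfl⟩ : ∃ N, n = N + 1 := ⟨n - 1, by lia⟩
  -- For two points no base `m ≥ 2` satisfies `m ≤ N`; the single edge of length 1 suffices since `x
  -- ≤ 2`.
  rcases eq_or_ne N 1 with rfl | hN1
  · have h := sum_rightGap_le_competitiveRatio hε hε1 (m := 2) (by norm_num)
      (by push_cast; linarith) A (n := 1) one_pos
    refine le_trans (ENNReal.ofReal_le_ofReal ?_) h
    have hr : rightGap 2 0 = 1 := by simp [rightGap]
    rw [Finset.sum_range_one, hr, div_mul_div_comm, one_mul, div_le_one (by positivity)]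
    push_cast at hn ⊢
    nlinarith
  have hN : 2 ≤ N := by lia
  -- Take `m = ⌊x⌋ - 1`, where the `- 1` gives `m ≤ N`, or `m = 2` if `⌊x⌋ ≤ 3`. In the latter case
  -- `log m` may exceed `log x`; the factor `D`, depending on `ε₀`, makes up for it.
  obtain ⟨m, hm, hεm, hmx, hmlog, hmN⟩ : ∃ m : ℕ, 1 < m ∧ ε * m < 2 ∧ x ≤ 4 * ((m : ℝ) - 1) ∧
      Real.log m ≤ D * Real.log x ∧ m ≤ N := by
    have hfl := Nat.floor_le (by linarith : 0 ≤ x)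
    have hfl' := Nat.lt_floor_add_one x
    have hfN : ⌊x⌋₊ ≤ N + 1 := by
      have : (⌊x⌋₊ : ℝ) ≤ ((N + 1 : ℕ) : ℝ) := hfl.trans hn
      exact_mod_cast this
    rcases le_or_gt ⌊x⌋₊ 3 with h3 | h3
    · have : (⌊x⌋₊ : ℝ) ≤ 3 := by exact_mod_cast h3
      refine ⟨2, one_lt_two, by push_cast; linarith, by push_cast; linarith, ?_, hN⟩
      exact_mod_cast h2D
    · have h4 : (4 : ℝ) ≤ ⌊x⌋₊ := by exact_mod_cast h3
      have hc : ((⌊x⌋₊ - 1 : ℕ) : ℝ) = ⌊x⌋₊ - 1 := by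
        rw [Nat.cast_sub (by lia)]
        simp
      refine ⟨⌊x⌋₊ - 1, by lia, ?_, ?_, ?_, by lia⟩
      · rw [hc]
        nlinarith
      · rw [hc]
        linarith
      · calc Real.log ((⌊x⌋₊ - 1 : ℕ) : ℝ) ≤ Real.log x :=
              Real.log_le_log (by rw [hc]; linarith) (by rw [hc]; linarith)
          _ ≤ D * Real.log x := le_mul_of_one_le_left hl1.le hD1
  refine le_trans (ENNReal.ofReal_le_ofReal ?_)
    (sum_rightGap_le_competitiveRatio hε hε1 hm hεm A (by lia : 0 < N))
  set K := Nat.log m N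
  have hK1 : (1 : ℝ) ≤ K := by exact_mod_cast Nat.log_pos hm hmN
  have hKN : m ^ K ≤ N := Nat.pow_log_le_self m (by lia)
  have hNK : N < m ^ (K + 1) := Nat.lt_pow_succ_log_self hm N
  have hm1 : (1 : ℝ) < m := by exact_mod_cast hm
  have hlogm : 0 < Real.log m := Real.log_pos hm1
  have hN0 : (0 : ℝ) < N := by exact_mod_cast (by lia : 0 < N)
  have hlogN : Real.log N ≤ (K + 1) * Real.log m := by
    have : Real.log N ≤ Real.log ((m : ℝ) ^ (K + 1)) :=
      Real.log_le_log hN0 (by exact_mod_cast hNK.le)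
    rw [Real.log_pow] at this
    exact_mod_cast this
  have hlogN1 : Real.log ((N + 1 : ℕ) : ℝ) ≤ 2 * Real.log N := by
    have : Real.log ((N + 1 : ℕ) : ℝ) ≤ Real.log ((N : ℝ) ^ 2) :=
      Real.log_le_log (by positivity) (by exact_mod_cast (by nlinarith : N + 1 ≤ N ^ 2))
    rw [Real.log_pow] at this
    exact_mod_cast this
  -- One factor 2 passes from `N + 1` to `N`, the other from `K + 1` to `K`. With `x ≤ 4 (m - 1)`
  -- and the `1/4` per level this makes 64.
  have hlog : Real.log ((N + 1 : ℕ) : ℝ) ≤ 4 * K * (D * Real.log x) := by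
    have h1 : (K + 1) * Real.log m ≤ 2 * K * Real.log m := by gcongr; linarith
    have h2 : 4 * K * Real.log m ≤ 4 * K * (D * Real.log x) := by gcongr
    linarith
  have hsum : K * (((m : ℝ) - 1) / 4) ≤ ∑ i ∈ Finset.range N, rightGap m i :=
    (mul_le_sum_rightGap hm K).trans (Finset.sum_le_sum_of_subset_of_nonneg
      (Finset.range_subset_range.2 hKN) fun i _ _ => (rightGap_pos hm i).le)
  refine le_trans ?_ hsum
  rw [div_mul_div_comm, one_mul, div_le_iff₀ (by positivity)]
  calc x * Real.log ((N + 1 : ℕ) : ℝ) ≤ 4 * ((m : ℝ) - 1) * (4 * K * (D * Real.log x)) := by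
        gcongr
    _ = K * (((m : ℝ) - 1) / 4) * (64 * D * Real.log x) := by ring

end LowerBound

end OnlineSpanner

theorem theorem1 :
    (∀ ε₀ : ℝ, 0 < ε₀ → ε₀ < 1 → ∃ c : ℝ, 0 < c ∧
      ∀ ε : ℝ, 0 < ε → ε ≤ ε₀ →
        ∀ A : OnlineSpanner.OnlineAlgorithm ℝ (1 + ε), ∀ n : ℕ, ε⁻¹ ≤ (n : ℝ) →
          ENNReal.ofReal (c * (ε⁻¹ * Real.log n / Real.log ε⁻¹)) ≤
            OnlineSpanner.competitiveRatio A n) ∧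
    (∃ C : ℝ, 0 < C ∧
      ∀ ε : ℝ, 0 < ε → ε < 1 →
        ∃ A : OnlineSpanner.OnlineAlgorithm ℝ (1 + ε), ∀ n : ℕ, 2 ≤ n →
          OnlineSpanner.competitiveRatio A n ≤
            ENNReal.ofReal (C * (ε⁻¹ * Real.log n / Real.log ε⁻¹))) := by
  refine ⟨fun ε₀ h0 h1 => ⟨_, ?_, fun ε hε hεε₀ A n hn =>
    OnlineSpanner.log_le_competitiveRatio h0 h1 hε hεε₀ A hn⟩, 14, by norm_num,
    fun ε hε hε1 => ⟨OnlineSpanner.greedyAlgorithm hε hε1, fun n hn =>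
      OnlineSpanner.competitiveRatio_greedyAlgorithm_le hε hε1 hn⟩⟩
  have := Real.log_pos ((one_lt_inv₀ h0).2 h1)
  have := Real.log_pos one_lt_two
  positivity
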